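/- **Setting.** Let $n\ge 1$, $t$ and $\delta$ be integers with $0\le t<n/2$ and $\delta\ge 1$. There are $n$ nodes, with identities $0,\dots,n-1$. Every ordered pair of nodes is joined by a channel of bounded capacity, which may lose, duplicate and reorder packets. An execution $R=(c_0,a_0,c_1,a_1,\dots)$ is an infinite alternating sequence of system states and atomic steps; $c_0$ is arbitrary. At most $t$ nodes crash in $R$; the others are called *correct* and never stop executing their do-forever loop. A message stays in a channel only for a finite period. Communication is fair: if a node sends the query (or the reply) of a given round infinitely often to a correct node, then that node receives it infinitely often, where the query (reply) of a round counts as one message even if the other fields change between retransmissions. **Algorithm** (code for $p_i$). The variables are a round number $r_i\in\mathbb N$, a set $\mathit{recFrom}_i$ of nodes, and counters $\mathit{count}_i[k]\in\mathbb N$, one for each node $p_k$. The procedure $\mathsf{check}()$ does the following: if $\max_k \mathit{count}_i[k]-\min_k \mathit{count}_i[k]>\delta$, then every $\mathit{count}_i[k]$ is set to $\max\{\mathit{count}_i[k],\ \max_l \mathit{count}_i[l]-\delta\}$. * *Do forever:* (1) send the query $\mathsf{ALIVE}(r_i,\mathit{count}_i)$ repeatedly to all other nodes until replies $\mathsf{RESPONSE}(r_i,\bullet,\mathit{recFrom}_j)$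 to the query of the current round have been received from $n-t$ nodes $p_j$ (the *winning* replies; a node always has its own reply). (2) Let $\mathit{prevRecFrom}$ be the union of the sets $\mathit{recFrom}_j$ in these replies; for every $j\notin \mathit{prevRecFrom}$ with $\mathit{count}_i[j]<\delta+\min_k\mathit{count}_i[k]$, increment $\mathit{count}_i[j]$. (3) Set $\mathit{recFrom}_i$ to the set of the senders of the winning replies. (4) Run $\mathsf{check}()$ and proceed to the next round, $r_i:=r_i+1$. * *When $\mathsf{ALIVE}(r',\mathit{count}')$ arrives from $p_j$:* set $\mathit{count}_i[k]:=\max\{\mathit{count}_i[k],\mathit{count}'[k]\}$ for all $k$, run $\mathsf{check}()$, and send $\mathsf{RESPONSE}(r',\mathit{count}_i,\mathit{recFrom}_i)$ to $p_j$. * *When $\mathsf{RESPONSE}(r',\mathit{count}',\bullet)$ arrives:* set $\mathit{count}_i[k]:=\max\{\mathit{count}_i[k],\mathit{count}'[k]\}$ for all $k$ and run $\mathsf{check}()$. At any time, $\mathit{leader}_i$ is the $x$ for which the pair $(\mathit{count}_i[x],x)$ is lexicographically minimal. **Theorem (Closure).** Let $R$ be an execution of this algorithm such that * $c_0$ is consistent,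 i.e. $\max_k \mathit{count}_i[k]-\min_k \mathit{count}_i[k]\le\delta$ holds in $c_0$ for every correct $p_i$; and * $R$ has an eventual message pattern, i.e. there are a system state $c_\tau$, a correct node $p_i$ and a set $Q$ of $t+1$ nodes such that, after $c_\tau$, every $p_j\in Q$ has, until it possibly crashes, the reply of $p_i$ among the winning replies to each of its queries. Then the algorithm implements the eventual leader failure detector $\Omega$ in $R$: every $\mathit{leader}_i$ always contains a node identity, and there are a correct node $p_\ell$ and a system state $c_{\tau_0}$ such that $\mathit{leader}_i=\ell$ for every correct $p_i$ in every system state from $c_{\tau_0}$ on. -/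

import Mathlib

namespace OmegaFD

/-! ## Messages, local states, configurations.  Node identities are the elements of `Fin n`. -/

/-- `alive r count` is a query of round `r`; `response r count recFrom` is a reply to a query of
round `r`. -/
inductive Message (n : ℕ) where
  | alive (r : ℕ) (count : Fin n → ℕ)
  | response (r : ℕ) (count : Fin n → ℕ) (recFrom : Finset (Fin n))
  deriving DecidableEq

/-- The two kinds of messages. -/
inductive Kind where
  | alive
  | response

/-- The kind and the round number of a message, without the rest of its payload. -/
def Message.tag {n : ℕ} : Message n → Kind × ℕ
  | .alive r _ => (.alive, r)
  | .response r _ _ => (.response, r)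

/-- The local variables of a node, together with the control part of its state:
* `toSend`: the nodes to which the current pass of the inner `foreach` still has to send the query;
* `replies j`: the set `recFromJ` of the reply of `p_j` to the current query, if that reply is among
  the first `n - t` ones (the winning ones) and has already been received;
* `inbox`: the message, with its sender, that the node has received but not yet processed. -/
structure NodeState (n : ℕ) where
  r : ℕ
  recFrom : Finset (Fin n)
  count : Fin n → ℕ
  toSend : Finset (Fin n)
  replies : Fin n → Option (Finset (Fin n))
  inbox : Option (Fin n × Message n)

/-- System states.  `chan i j` holds the packets in transit from `p_i` to `p_j`; since packets may
be reordered, it is a multiset.  `crashed` is the set of nodes that have already failed. -/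
structure Config (n : ℕ) where
  node : Fin n → NodeState n
  chan : Fin n → Fin n → Multiset (Message n)
  crashed : Finset (Fin n)

/-! ## The local computations of the algorithm -/

section Local

variable {n : ℕ} [NeZero n]

/-- `max counts()` -/
def maxCount (count : Fin n → ℕ) : ℕ := Finset.univ.sup' Finset.univ_nonempty count

/-- `min counts()` -/
def minCount (count : Fin n → ℕ) : ℕ := Finset.univ.inf' Finset.univ_nonempty count

/-- `check()`: if the gap between the extrema exceeds `δ`, raise all entries to at least
`max counts() - δ`. -/
def check (δ : ℕ) (count : Fin n → ℕ) : Fin n → ℕ :=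
  if maxCount count - minCount count > δ then fun k => max (count k) (maxCount count - δ)
  else count

/-- Entrywise maximum, used when a message with counters arrives. -/
def merge (count countJ : Fin n → ℕ) : Fin n → ℕ := fun k => max (count k) (countJ k)

/-- `foreach j ∉ prevRecFrom : count[j] < δ + min counts() do count[j] := count[j] + 1`. -/
def suspect (δ : ℕ) (prevRecFrom : Finset (Fin n)) (count : Fin n → ℕ) : Fin n → ℕ :=
  fun j => if j ∉ prevRecFrom ∧ count j < δ + minCount count then count j + 1 else count j

/-- `leader()`: the second component of the lexicographic minimum of the pairs `(count[k], k)`. -/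
def leader (count : Fin n → ℕ) : Fin n :=
  (ofLex ((Finset.univ.image fun k : Fin n => toLex (count k, k)).min'
    (Finset.univ_nonempty.image _))).2

/-- The nodes whose (winning) reply to the current query `p_i` has; a node always has its own
reply. -/
def NodeState.winners (s : NodeState n) (i : Fin n) : Finset (Fin n) :=
  Finset.univ.filter fun j => j = i ∨ (s.replies j).isSome

/-- The union of the sets `recFromJ` over the winning replies, the node's own reply included. -/
def NodeState.prevRecFrom (s : NodeState n) : Finset (Fin n) :=
  s.recFrom ∪ Finset.univ.biUnion fun j => (s.replies j).getD ∅

/-- The part of an iteration of the do-forever loop of `p_i` after the `repeat` loop, and the start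
of the next iteration, with a new round number and no replies yet. -/
def NodeState.endIteration (δ : ℕ) (i : Fin n) (s : NodeState n) : NodeState n where
  r := s.r + 1
  recFrom := s.winners i
  count := check δ (suspect δ s.prevRecFrom s.count)
  toSend := Finset.univ.erase i
  replies := fun _ => none
  inbox := s.inbox

/-- The `until` test of the `repeat` loop: with replies from `n - t` nodes `p_i` leaves the loop,
otherwise it sends its query once more. -/
def NodeState.testLoop (t δ : ℕ) (i : Fin n) (s : NodeState n) : NodeState n :=
  if n - t ≤ (s.winners i).card then s.endIteration δ i
  else { s with toSend := Finset.univ.erase i }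

/-- `p_i` takes note of a reply of `p_j`, if it is a reply to the current query, the first one of
`p_j`, and among the first `n - t` ones. -/
def NodeState.record (t : ℕ) (i j : Fin n) (rJ : ℕ) (recFromJ : Finset (Fin n))
    (s : NodeState n) : NodeState n :=
  if rJ = s.r ∧ j ∉ s.winners i ∧ (s.winners i).card < n - t then
    { s with replies := Function.update s.replies j (some recFromJ) }
  else s

/-- Merge the received counters, call `check()`, and remove the message from the inbox. -/
def NodeState.absorb (δ : ℕ) (countJ : Fin n → ℕ) (s : NodeState n) : NodeState n :=
  { s with count := check δ (merge s.count countJ), inbox := none }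

/-- The new state of `p_i` when it processes the message `m` from `p_j`. -/
def NodeState.process (t δ : ℕ) (i j : Fin n) (m : Message n) (s : NodeState n) : NodeState n :=
  match m with
  | .alive _ countJ => s.absorb δ countJ
  | .response rJ countJ recFromJ => (s.absorb δ countJ).record t i j rJ recFromJ

end Local

/-! ## Steps -/

/-- The steps.  The first four are taken by the node `i`, each with at most one communication
operation; the others by the environment.  The flag `kept` tells whether the packet that is sent
enters the channel or is lost at once. -/
inductive Action (n : ℕ) where
  /-- `p_i` sends its current query to `p_j` -/
  | sendAlive (i j : Fin n) (kept : Bool)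
  /-- `p_i`, having sent its query to all others, evaluates the `until` test -/
  | testLoop (i : Fin n)
  /-- `p_i` receives the message `m` from `p_j` -/
  | receive (i j : Fin n) (m : Message n)
  /-- `p_i` processes the message in its inbox and, if it is a query, sends the reply -/
  | handle (i : Fin n) (kept : Bool)
  /-- `p_i` crashes -/
  | crash (i : Fin n)
  /-- a packet `m` from `p_i` to `p_j` is omitted -/
  | lose (i j : Fin n) (m : Message n)
  /-- a packet `m` from `p_i` to `p_j` is duplicated -/
  | duplicate (i j : Fin n) (m : Message n)

/-- The step belongs to the do-forever loop of `p_i`. -/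
def Action.IsLoopStep {n : ℕ} (i : Fin n) : Action n → Prop
  | .sendAlive i' _ _ => i' = i
  | .testLoop i' => i' = i
  | _ => False

namespace Config

variable {n : ℕ}

/-- Replace the local state of `p_i`. -/
def setNode (c : Config n) (i : Fin n) (s : NodeState n) : Config n :=
  { c with node := Function.update c.node i s }

/-- Replace the content of the channel from `p_i` to `p_j`. -/
def setChan (c : Config n) (i j : Fin n) (M : Multiset (Message n)) : Config n :=
  { c with chan := Function.update c.chan i (Function.update (c.chan i) j M) }

/-- Send `m` from `p_i` to `p_j`. -/
def transmit (c : Config n) (i j : Fin n) (m : Message n) (kept : Bool) : Config n :=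
  if kept then c.setChan i j (m ::ₘ c.chan i j) else c

/-- When a step can be taken.  A crashed node takes no step, and a node with a message in its inbox
processes it before it does anything else. -/
def Enabled (c : Config n) : Action n → Prop
  | .sendAlive i j _ => i ∉ c.crashed ∧ (c.node i).inbox = none ∧ j ∈ (c.node i).toSend
  | .testLoop i => i ∉ c.crashed ∧ (c.node i).inbox = none ∧ (c.node i).toSend = ∅
  | .receive i j m => i ∉ c.crashed ∧ (c.node i).inbox = none ∧ m ∈ c.chan j i
  | .handle i _ => i ∉ c.crashed ∧ (c.node i).inbox ≠ none
  | .crash i => i ∉ c.crashed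
  | .lose i j m => m ∈ c.chan i j
  | .duplicate i j m => m ∈ c.chan i j

variable [NeZero n]

/-- The reply of a node in state `s` to a query of round `rJ`. -/
def replyTo (rJ : ℕ) (s : NodeState n) : Message n :=
  .response rJ s.count s.recFrom

/-- The sender, the addressee and the content of the message that a step sends, if it sends one. -/
def sent (δ : ℕ) (c : Config n) : Action n → Option (Fin n × Fin n × Message n)
  | .sendAlive i j _ => some (i, j, .alive (c.node i).r (c.node i).count)
  | .handle i _ =>
    match (c.node i).inbox with
    | some (j, .alive rJ countJ) => some (i, j, replyTo rJ ((c.node i).absorb δ countJ))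
    | _ => none
  | _ => none

/-- The system state that a step leads to. -/
def next (t δ : ℕ) (c : Config n) : Action n → Config n
  | .sendAlive i j kept =>
    (c.setNode i { c.node i with toSend := (c.node i).toSend.erase j }).transmit i j
      (.alive (c.node i).r (c.node i).count) kept
  | .testLoop i => c.setNode i ((c.node i).testLoop t δ i)
  | .receive i j m =>
    (c.setNode i { c.node i with inbox := some (j, m) }).setChan j i ((c.chan j i).erase m)
  | .handle i kept =>
    match (c.node i).inbox with
    | none => c
    | some (j, .alive rJ countJ) =>
      (c.setNode i ((c.node i).process t δ i j (.alive rJ countJ))).transmit i j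
        (replyTo rJ ((c.node i).absorb δ countJ)) kept
    | some (j, .response rJ countJ recFromJ) =>
      c.setNode i ((c.node i).process t δ i j (.response rJ countJ recFromJ))
  | .crash i => { c with crashed := insert i c.crashed }
  | .lose i j m => c.setChan i j ((c.chan i j).erase m)
  | .duplicate i j m => c.setChan i j (m ::ₘ c.chan i j)

end Config

/-! ## Executions -/

/-- An infinite execution of the self-stabilizing algorithm, with an arbitrary starting state:
an alternating sequence of system states and steps in which no channel ever holds more than
`channelCapacity` packets. -/
structure Execution (n t δ channelCapacity : ℕ) [NeZero n] where
  state : ℕ → Config n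
  action : ℕ → Action n
  enabled : ∀ τ, (state τ).Enabled (action τ)
  step : ∀ τ, state (τ + 1) = (state τ).next t δ (action τ)
  capacity : ∀ τ i j, ((state τ).chan i j).card ≤ channelCapacity

namespace Execution

variable {n t δ channelCapacity : ℕ} [NeZero n] (R : Execution n t δ channelCapacity)

/-- The failure pattern. -/
def F (τ : ℕ) : Finset (Fin n) := (R.state τ).crashed

/-- The nodes that fail at some time. -/
def faulty : Set (Fin n) := {i | ∃ τ, i ∈ R.F τ}

/-- The nodes that never fail. -/
def correct : Set (Fin n) := R.faultyᶜ

/-- The step from `c_τ` sends the message `m` from `p_i` to `p_j` (even if `m` gets lost). -/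
def Sends (τ : ℕ) (i j : Fin n) (m : Message n) : Prop :=
  (R.state τ).sent δ (R.action τ) = some (i, j, m)

/-- In the step from `c_τ`, node `p_j` receives the message `m` from `p_i`. -/
def Receives (τ : ℕ) (i j : Fin n) (m : Message n) : Prop :=
  R.action τ = .receive j i m

/-- Fair communication: if `p_i` sends a query (or a reply) of a given round infinitely often to
the non-faulty node `p_j`, then `p_j` receives it infinitely often.  The query of a round counts as
one message, though its field `count` may have changed from one retransmission to the next;
likewise for the replies to it. -/
def FairCommunication : Prop :=
  ∀ (i j : Fin n) (g : Kind × ℕ), j ∈ R.correct →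
    (∃ᶠ τ in Filter.atTop, ∃ m, m.tag = g ∧ R.Sends τ i j m) →
    ∃ᶠ τ in Filter.atTop, ∃ m, m.tag = g ∧ R.Receives τ i j m

/-- A message resides in a channel only for a finite period: it leaves the channel for good, unless
it is sent over and over again. -/
def FiniteResidence : Prop :=
  ∀ (i j : Fin n) (m : Message n),
    (∀ᶠ τ in Filter.atTop, ¬ R.Sends τ i j m) →
    ∀ᶠ τ in Filter.atTop, m ∉ (R.state τ).chan i j

/-- The standing assumptions on executions: at most `t` nodes fail, the others never stop executing
their do-forever loop, and the assumptions on the channels hold. -/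
structure Admissible : Prop where
  failures : R.faulty.ncard ≤ t
  progress : ∀ i ∈ R.correct, ∃ᶠ τ in Filter.atTop, (R.action τ).IsLoopStep i
  fair : R.FairCommunication
  residence : R.FiniteResidence

/-- The system state `c_τ` is consistent. -/
def ConsistentAt (τ : ℕ) : Prop :=
  ∀ i ∈ R.correct,
    maxCount ((R.state τ).node i).count - minCount ((R.state τ).node i).count ≤ δ

/-- In the step from `c_τ`, node `p_j` stops waiting for replies to its current query and completes
an iteration of its do-forever loop. -/
def CompletesQuery (τ : ℕ) (j : Fin n) : Prop :=
  R.action τ = .testLoop j ∧ n - t ≤ (((R.state τ).node j).winners j).card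

/-- Eventual message pattern: there are a system state `c_τ`, a non-faulty `p_i` and a set `Q` of
`t + 1` nodes, such that, after `c_τ`, whenever a node of `Q` completes a query, the reply of `p_i`
is among the `n - t` winning ones. -/
def EventualMessagePattern : Prop :=
  ∃ τ : ℕ, ∃ i ∈ R.correct, ∃ Q : Finset (Fin n), Q.card = t + 1 ∧
    ∀ j ∈ Q, ∀ τ' ≥ τ, R.CompletesQuery τ' j → i ∈ ((R.state τ').node j).winners j

/-- The value that `leader()` has at `p_i` in `c_τ`. -/
def leaderAt (τ : ℕ) (i : Fin n) : Fin n := leader ((R.state τ).node i).count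

/-- The execution implements the eventual leader failure detector: every `leader_i` always holds a
node identity, and from some system state on, the `leader_i` of all correct nodes hold one and the
same correct node. -/
structure ImplementsOmega : Prop where
  validity : ∀ i τ, R.leaderAt τ i ∈ (Finset.univ : Finset (Fin n))
  eventualLeadership :
    ∃ l ∈ R.correct, ∃ τ, ∀ τ' ≥ τ, ∀ i ∈ R.correct, R.leaderAt τ' i = l

end Execution

end OmegaFD

/-!
The proof follows the counters of the correct nodes to their final values.

*Old packets.*  A property of all messages that are sent along a channel from some time on eventually
holds of all packets in that channel (`Execution.eventually_chan`): the packets from before that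
time are finitely many, and each leaves the channel for good unless it is sent again.  The property
passes to the inbox of a correct receiver (`Execution.eventually_inbox`) and to its recorded replies
(`Execution.eventually_replies`), because these are erased with every completed query.  In
particular the messages of a faulty node disappear altogether.

*Liveness.*  A correct node completes infinitely many queries
(`Execution.frequently_completesQuery`): otherwise it would send the query of one fixed round over and
over again, fairness would bring it the replies of all correct nodes, and these are at least `n - t`.

*Stabilization.*  Call a counter vector balanced if its entries lie within `δ` of each other.  Merging
and suspecting preserve balance, and eventually all vectors in use are balanced, so that `check` has
no effect.  The winners of a query meet the set `Q` of the message pattern, hence the node `p_i` of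
the pattern is eventually never suspected (`Execution.eventually_mem_prevRecFrom`).  From then on
its counters are only copied, so they are bounded (`Execution.exists_bound_count`).  By balance all
counters of correct nodes are bounded, and since they never decrease, they become constant.

*Agreement.*  A recurrent winner of the queries of `p_k` exchanges messages with `p_k` infinitely often
in both directions, so the two have the same final counters (`Execution.eq_of_frequently_replies`).
Each correct node has at least `n - t > n / 2` recurrent winners, itself included, so any two
correct nodes share one, and all final vectors are equal (`Execution.final_count_eq`).
Fairness alone does not make two given correct nodes communicate directly, since the query of each
round is sent only finitely often.

*The leader is correct.*  A faulty node is eventually suspected at every completed query, so its final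
counter is at least `δ` above the minimum, whereas the leader attains the minimum
(`Execution.leader_mem_correct`).
-/

namespace OmegaFD

open Filter

/-! ### Counter vectors -/

section Counters

variable {n : ℕ} [NeZero n]

/-- A counter vector is balanced if no two of its entries differ by more than `δ`. -/
def Balanced (δ : ℕ) (c : Fin n → ℕ) : Prop := ∀ a b, c a ≤ c b + δ

lemma le_maxCount (c : Fin n → ℕ) (a : Fin n) : c a ≤ maxCount c :=
  Finset.le_sup' c (Finset.mem_univ a)

lemma minCount_le (c : Fin n → ℕ) (a : Fin n) : minCount c ≤ c a :=
  Finset.inf'_le c (Finset.mem_univ a)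

lemma exists_eq_maxCount (c : Fin n → ℕ) : ∃ a, maxCount c = c a := by
  obtain ⟨a, -, ha⟩ := Finset.exists_mem_eq_sup' Finset.univ_nonempty c
  exact ⟨a, ha⟩

lemma exists_eq_minCount (c : Fin n → ℕ) : ∃ a, minCount c = c a := by
  obtain ⟨a, -, ha⟩ := Finset.exists_mem_eq_inf' Finset.univ_nonempty c
  exact ⟨a, ha⟩

lemma balanced_iff {δ : ℕ} {c : Fin n → ℕ} :
    Balanced δ c ↔ maxCount c - minCount c ≤ δ := by
  constructor
  · intro h
    obtain ⟨a, ha⟩ := exists_eq_maxCount c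
    obtain ⟨b, hb⟩ := exists_eq_minCount c
    have := h a b
    omega
  · intro h a b
    have := le_maxCount c a
    have := minCount_le c b
    omega

lemma balanced_check (δ : ℕ) (c : Fin n → ℕ) : Balanced δ (check δ c) := by
  unfold check
  split_ifs with h
  · intro a b
    have := le_maxCount c a
    show max (c a) _ ≤ max (c b) _ + δ
    omega
  · exact balanced_iff.2 (not_lt.1 h)

lemma Balanced.check_eq {δ : ℕ} {c : Fin n → ℕ} (h : Balanced δ c) : check δ c = c :=
  if_neg (not_lt.2 (balanced_iff.1 h))

omit [NeZero n] in
lemma Balanced.merge {δ : ℕ} {c d : Fin n → ℕ} (hc : Balanced δ c) (hd : Balanced δ d) :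
    Balanced δ (merge c d) := by
  intro a b
  have := hc a b
  have := hd a b
  show max (c a) (d a) ≤ max (c b) (d b) + δ
  omega

lemma le_check (δ : ℕ) (c : Fin n → ℕ) : c ≤ check δ c := by
  intro a
  unfold check
  split_ifs
  · exact le_max_left _ _
  · exact le_rfl

lemma le_suspect (δ : ℕ) (P : Finset (Fin n)) (c : Fin n → ℕ) : c ≤ suspect δ P c := by
  intro a
  unfold suspect
  split_ifs
  · exact Nat.le_succ _
  · exact le_rfl

lemma Balanced.suspect {δ : ℕ} {c : Fin n → ℕ} (hc : Balanced δ c) (P : Finset (Fin n)) :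
    Balanced δ (suspect δ P c) := by
  intro a b
  have h1 := hc a b
  have h2 := minCount_le c b
  have h3 : c b ≤ OmegaFD.suspect δ P c b := le_suspect δ P c b
  have h4 : OmegaFD.suspect δ P c a ≤ c b + δ := by
    unfold OmegaFD.suspect
    split_ifs <;> omega
  omega

lemma leader_count_le (c : Fin n → ℕ) (a : Fin n) : c (leader c) ≤ c a := by
  have hne : (Finset.univ.image fun k : Fin n => toLex (c k, k)).Nonempty :=
    Finset.univ_nonempty.image _
  obtain ⟨l, -, hl⟩ := Finset.mem_image.1 (Finset.min'_mem _ hne)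
  have hlead : leader c = l := by
    unfold leader
    rw [← hl]
    rfl
  have hle := Finset.min'_le _ _
    (Finset.mem_image_of_mem (fun k : Fin n => toLex (c k, k)) (Finset.mem_univ a))
  rw [← hl, Prod.Lex.toLex_le_toLex] at hle
  rw [hlead]
  rcases hle with h | h
  · exact h.le
  · exact h.1.le

end Counters

/-- The counters carried by a message. -/
def Message.count {n : ℕ} : Message n → Fin n → ℕ
  | .alive _ c => c
  | .response _ c _ => c

/-! ### Local steps -/

section Local

variable {n : ℕ} [NeZero n] {t δ : ℕ}

omit [NeZero n] in
lemma NodeState.mem_winners {s : NodeState n} {i j : Fin n} :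
    j ∈ s.winners i ↔ j = i ∨ (s.replies j).isSome := by
  simp [NodeState.winners]

lemma NodeState.process_count (s : NodeState n) (i j : Fin n) (m : Message n) :
    (s.process t δ i j m).count = check δ (merge s.count m.count) := by
  cases m with
  | alive r c => rfl
  | response r c rf =>
    simp only [NodeState.process, NodeState.record]
    split_ifs <;> rfl

lemma NodeState.process_inbox (s : NodeState n) (i j : Fin n) (m : Message n) :
    (s.process t δ i j m).inbox = none := by
  cases m with
  | alive r c => rfl
  | response r c rf =>
    simp only [NodeState.process, NodeState.record]
    split_ifs <;> rfl

lemma NodeState.process_r (s : NodeState n) (i j : Fin n) (m : Message n) :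
    (s.process t δ i j m).r = s.r := by
  cases m with
  | alive r c => rfl
  | response r c rf =>
    simp only [NodeState.process, NodeState.record]
    split_ifs <;> rfl

lemma NodeState.process_recFrom (s : NodeState n) (i j : Fin n) (m : Message n) :
    (s.process t δ i j m).recFrom = s.recFrom := by
  cases m with
  | alive r c => rfl
  | response r c rf =>
    simp only [NodeState.process, NodeState.record]
    split_ifs <;> rfl

lemma NodeState.process_toSend (s : NodeState n) (i j : Fin n) (m : Message n) :
    (s.process t δ i j m).toSend = s.toSend := by
  cases m with
  | alive r c => rfl
  | response r c rf =>
    simp only [NodeState.process, NodeState.record]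
    split_ifs <;> rfl

/-- A processed message only adds to the recorded replies, and only the reply that it carries. -/
lemma NodeState.process_replies (s : NodeState n) (i j : Fin n) (m : Message n) (a : Fin n) :
    (s.process t δ i j m).replies a = s.replies a ∨
      a = j ∧ s.replies a = none ∧
        ∃ r c rf, m = .response r c rf ∧ (s.process t δ i j m).replies a = some rf := by
  cases m with
  | alive r c => exact Or.inl rfl
  | response r c rf =>
    simp only [NodeState.process, NodeState.record]
    split_ifs with h
    · by_cases haj : a = j
      · refine Or.inr ⟨haj, ?_, r, c, rf, rfl, by simp [haj]⟩
        have := h.2.1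
        rw [NodeState.mem_winners, not_or] at this
        subst haj
        exact Option.not_isSome_iff_eq_none.1 this.2
      · exact Or.inl (by simp [haj, NodeState.absorb])
    · exact Or.inl rfl

lemma NodeState.winners_subset_process (s : NodeState n) (i j : Fin n) (m : Message n) (k : Fin n) :
    s.winners k ⊆ (s.process t δ i j m).winners k := by
  intro a ha
  rw [NodeState.mem_winners] at ha ⊢
  rcases s.process_replies (t := t) (δ := δ) i j m a with h | ⟨-, h, -⟩
  · rwa [h]
  · exact Or.inl (ha.resolve_right (by simp [h]))

/-- After a reply to the current query has been processed, either its sender counts as a winner or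
there are enough winners already. -/
lemma NodeState.mem_winners_process (s : NodeState n) (i j : Fin n) (c : Fin n → ℕ)
    (rf : Finset (Fin n)) :
    j ∈ (s.process t δ i j (.response s.r c rf)).winners i ∨
      n - t ≤ ((s.process t δ i j (.response s.r c rf)).winners i).card := by
  by_cases h1 : j ∈ s.winners i
  · exact Or.inl (s.winners_subset_process i j _ i h1)
  by_cases h2 : (s.winners i).card < n - t
  · left
    have h : s.r = (s.absorb δ c).r ∧ j ∉ (s.absorb δ c).winners i ∧
      ((s.absorb δ c).winners i).card < n - t := ⟨rfl, h1, h2⟩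
    simp only [NodeState.process, NodeState.record]
    rw [if_pos h, NodeState.mem_winners]
    simp
  · exact Or.inr ((not_lt.1 h2).trans
      (Finset.card_le_card (s.winners_subset_process i j _ i)))

end Local

/-! ### Steps of an execution -/

namespace Execution

variable {n t δ channelCapacity : ℕ} [NeZero n] (R : Execution n t δ channelCapacity)

/-- The local state of `p_k` in `c_τ`. -/
def node (τ : ℕ) (k : Fin n) : NodeState n := (R.state τ).node k

/-- The ways in which one step can change the local state of `p_k`. -/
lemma node_succ (τ : ℕ) (k : Fin n) :
    R.node (τ + 1) k = R.node τ k ∨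
    (∃ j kept, R.action τ = .sendAlive k j kept ∧ (R.node τ k).inbox = none ∧
      R.node (τ + 1) k = { R.node τ k with toSend := (R.node τ k).toSend.erase j }) ∨
    (R.action τ = .testLoop k ∧ (R.node τ k).inbox = none ∧
      R.node (τ + 1) k = (R.node τ k).testLoop t δ k) ∨
    (∃ j m, R.action τ = .receive k j m ∧ m ∈ (R.state τ).chan j k ∧
      R.node (τ + 1) k = { R.node τ k with inbox := some (j, m) }) ∨
    (∃ j m kept, R.action τ = .handle k kept ∧ (R.node τ k).inbox = some (j, m) ∧
      R.node (τ + 1) k = (R.node τ k).process t δ k j m) := by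
  have hE := R.enabled τ
  have hS := R.step τ
  unfold node
  rw [hS]
  cases hA : R.action τ with
  | sendAlive i j kept =>
    rw [hA] at hE
    by_cases hik : k = i
    · subst hik
      refine Or.inr (Or.inl ⟨j, kept, rfl, hE.2.1, ?_⟩)
      cases kept <;> simp [Config.next, Config.transmit, Config.setNode, Config.setChan]
    · left
      cases kept <;> simp [Config.next, Config.transmit, Config.setNode, Config.setChan, hik]
  | testLoop i =>
    rw [hA] at hE
    by_cases hik : k = i
    · subst hik
      exact Or.inr (Or.inr (Or.inl ⟨rfl, hE.2.1, by simp [Config.next, Config.setNode]⟩))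
    · left
      simp [Config.next, Config.setNode, hik]
  | receive i j m =>
    rw [hA] at hE
    by_cases hik : k = i
    · subst hik
      exact Or.inr (Or.inr (Or.inr (Or.inl ⟨j, m, rfl, hE.2.2, by
        simp [Config.next, Config.setNode, Config.setChan]⟩)))
    · left
      simp [Config.next, Config.setNode, Config.setChan, hik]
  | handle i kept =>
    rw [hA] at hE
    by_cases hik : k = i
    · subst hik
      obtain ⟨⟨j, m⟩, hm⟩ := Option.ne_none_iff_exists'.1 hE.2
      refine Or.inr (Or.inr (Or.inr (Or.inr ⟨j, m, kept, rfl, hm, ?_⟩)))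
      cases m <;> cases kept <;>
        simp [Config.next, hm, Config.transmit, Config.setNode, Config.setChan]
    · left
      rcases hm : ((R.state τ).node i).inbox with _ | ⟨j, m⟩
      · simp [Config.next, hm]
      · cases m <;> cases kept <;>
          simp [Config.next, hm, Config.transmit, Config.setNode, Config.setChan, hik]
  | crash i => exact Or.inl rfl
  | lose i j m => exact Or.inl rfl
  | duplicate i j m => exact Or.inl rfl

variable {R}

omit [NeZero n] in
lemma mem_setChan {c : Config n} {i j a b : Fin n} {M : Multiset (Message n)} {m : Message n}
    (h : m ∈ (c.setChan i j M).chan a b) : m ∈ c.chan a b ∨ (a = i ∧ b = j ∧ m ∈ M) := by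
  by_cases hai : a = i
  · by_cases hbj : b = j
    · subst hai hbj
      simp only [Config.setChan, Function.update_self] at h
      exact Or.inr ⟨rfl, rfl, h⟩
    · subst hai
      simp only [Config.setChan, Function.update_self, Function.update_of_ne hbj] at h
      exact Or.inl h
  · simp only [Config.setChan, Function.update_of_ne hai] at h
    exact Or.inl h

omit [NeZero n] in
lemma mem_transmit {c : Config n} {i j a b : Fin n} {kept : Bool} {m m' : Message n}
    (h : m ∈ (c.transmit i j m' kept).chan a b) :
    m ∈ c.chan a b ∨ (a = i ∧ b = j ∧ m = m') := by
  unfold Config.transmit at h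
  split_ifs at h
  · rcases mem_setChan h with h | ⟨rfl, rfl, h⟩
    · exact Or.inl h
    · rcases Multiset.mem_cons.1 h with h | h
      · exact Or.inr ⟨rfl, rfl, h⟩
      · exact Or.inl h
  · exact Or.inl h

/-- A packet in transit after a step was in transit before it, or the step sends it. -/
lemma mem_chan_succ {τ : ℕ} {a b : Fin n} {m : Message n}
    (h : m ∈ (R.state (τ + 1)).chan a b) : m ∈ (R.state τ).chan a b ∨ R.Sends τ a b m := by
  have hE := R.enabled τ
  rw [R.step τ] at h
  unfold Sends
  cases hA : R.action τ with
  | sendAlive i j kept =>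
    rw [hA] at h
    rcases mem_transmit h with h | ⟨rfl, rfl, rfl⟩
    · exact Or.inl h
    · exact Or.inr rfl
  | testLoop i =>
    rw [hA] at h
    exact Or.inl h
  | receive i j m' =>
    rw [hA] at h
    rcases mem_setChan h with h | ⟨rfl, rfl, h⟩
    · exact Or.inl h
    · exact Or.inl (Multiset.mem_of_mem_erase h)
  | handle i kept =>
    rw [hA] at h
    rcases hm : ((R.state τ).node i).inbox with _ | ⟨j, m'⟩
    · simp only [Config.next, hm] at h
      exact Or.inl h
    · cases m' with
      | alive r c =>
        simp only [Config.next, hm] at h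
        rcases mem_transmit h with h | ⟨rfl, rfl, rfl⟩
        · exact Or.inl h
        · exact Or.inr (by simp [Config.sent, hm])
      | response r c rf =>
        simp only [Config.next, hm] at h
        exact Or.inl h
  | crash i =>
    rw [hA] at h
    exact Or.inl h
  | lose i j m' =>
    rw [hA] at h
    rcases mem_setChan h with h | ⟨rfl, rfl, h⟩
    · exact Or.inl h
    · exact Or.inl (Multiset.mem_of_mem_erase h)
  | duplicate i j m' =>
    rw [hA] at h hE
    rcases mem_setChan h with h | ⟨rfl, rfl, h⟩
    · exact Or.inl h
    · rcases Multiset.mem_cons.1 h with rfl | h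
      · exact Or.inl hE
      · exact Or.inl h

/-- The two occasions on which a node sends: within its loop, and when it processes a query. -/
lemma Sends.cases {τ : ℕ} {a b : Fin n} {m : Message n} (h : R.Sends τ a b m) :
    (∃ kept, R.action τ = .sendAlive a b kept ∧ m = .alive (R.node τ a).r (R.node τ a).count) ∨
    (∃ kept r c, R.action τ = .handle a kept ∧ (R.node τ a).inbox = some (b, .alive r c) ∧
      m = Config.replyTo r ((R.node τ a).absorb δ c)) := by
  unfold Sends at h
  unfold node
  cases hA : R.action τ with
  | sendAlive i j kept =>
    rw [hA] at h
    simp only [Config.sent, Option.some.injEq, Prod.mk.injEq] at h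
    obtain ⟨rfl, rfl, rfl⟩ := h
    exact Or.inl ⟨kept, rfl, rfl⟩
  | handle i kept =>
    rw [hA] at h
    rcases hm : ((R.state τ).node i).inbox with _ | ⟨j, m'⟩
    · simp [Config.sent, hm] at h
    · cases m' with
      | alive r c =>
        simp only [Config.sent, hm, Option.some.injEq, Prod.mk.injEq] at h
        obtain ⟨rfl, rfl, rfl⟩ := h
        exact Or.inr ⟨kept, r, c, rfl, hm, rfl⟩
      | response r c rf => simp [Config.sent, hm] at h
  | _ => rw [hA] at h; simp [Config.sent] at h

lemma Sends.not_mem_crashed {τ : ℕ} {a b : Fin n} {m : Message n} (h : R.Sends τ a b m) :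
    a ∉ R.F τ := by
  have hE := R.enabled τ
  rcases h.cases with ⟨kept, hA, -⟩ | ⟨kept, r, c, hA, -⟩ <;> rw [hA] at hE <;> exact hE.1

lemma node_succ_of_handle {τ : ℕ} {k j : Fin n} {kept : Bool} {m : Message n}
    (hA : R.action τ = .handle k kept) (hm : (R.node τ k).inbox = some (j, m)) :
    R.node (τ + 1) k = (R.node τ k).process t δ k j m := by
  unfold node at hm ⊢
  rw [R.step τ, hA]
  cases m <;> cases kept <;>
    simp [Config.next, hm, Config.transmit, Config.setNode, Config.setChan]

lemma node_succ_of_sendAlive {τ : ℕ} {k j : Fin n} {kept : Bool}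
    (hA : R.action τ = .sendAlive k j kept) :
    R.node (τ + 1) k = { R.node τ k with toSend := (R.node τ k).toSend.erase j } := by
  unfold node
  rw [R.step τ, hA]
  cases kept <;> simp [Config.next, Config.transmit, Config.setNode, Config.setChan]

lemma node_succ_of_testLoop {τ : ℕ} {k : Fin n} (hA : R.action τ = .testLoop k) :
    R.node (τ + 1) k = (R.node τ k).testLoop t δ k := by
  unfold node
  rw [R.step τ, hA]
  simp [Config.next, Config.setNode]

lemma node_succ_of_receive {τ : ℕ} {k j : Fin n} {m : Message n}
    (hA : R.action τ = .receive k j m) :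
    R.node (τ + 1) k = { R.node τ k with inbox := some (j, m) } := by
  unfold node
  rw [R.step τ, hA]
  simp [Config.next, Config.setNode, Config.setChan]

lemma node_succ_of_completesQuery {τ : ℕ} {k : Fin n} (h : R.CompletesQuery τ k) :
    R.node (τ + 1) k = (R.node τ k).endIteration δ k := by
  rw [node_succ_of_testLoop h.1, NodeState.testLoop]
  exact if_pos h.2

/-- The counters in a message are those of its sender right after the sending step. -/
lemma Sends.count_eq {τ : ℕ} {a b : Fin n} {m : Message n} (h : R.Sends τ a b m) :
    m.count = (R.node (τ + 1) a).count := by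
  rcases h.cases with ⟨kept, hA, rfl⟩ | ⟨kept, r, c, hA, hm, rfl⟩
  · rw [node_succ_of_sendAlive hA]; rfl
  · rw [node_succ_of_handle hA hm]; rfl

lemma Sends.recFrom_eq {τ : ℕ} {a b : Fin n} {r : ℕ} {c : Fin n → ℕ} {rf : Finset (Fin n)}
    (h : R.Sends τ a b (.response r c rf)) : rf = (R.node τ a).recFrom := by
  rcases h.cases with ⟨kept, hA, h⟩ | ⟨kept, r, c, hA, hm, h⟩
  · cases h
  · cases h; rfl

/-- The counters of a node change only when it completes a query or processes a message. -/
lemma count_succ (τ : ℕ) (k : Fin n) :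
    (R.node (τ + 1) k).count = (R.node τ k).count ∨
    (R.CompletesQuery τ k ∧ (R.node (τ + 1) k).count =
      check δ (suspect δ (R.node τ k).prevRecFrom (R.node τ k).count)) ∨
    (∃ j m, (R.node τ k).inbox = some (j, m) ∧
      (R.node (τ + 1) k).count = check δ (merge (R.node τ k).count m.count)) := by
  rcases R.node_succ τ k with h | ⟨j, kept, hA, -, h⟩ | ⟨hA, -, h⟩ | ⟨j, m, hA, -, h⟩ |
    ⟨j, m, kept, hA, hm, h⟩
  · exact Or.inl (by rw [h])
  · exact Or.inl (by rw [h])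
  · by_cases hw : n - t ≤ ((R.node τ k).winners k).card
    · exact Or.inr (Or.inl ⟨⟨hA, hw⟩, by rw [node_succ_of_completesQuery ⟨hA, hw⟩]; rfl⟩)
    · exact Or.inl (by rw [h, NodeState.testLoop, if_neg hw])
  · exact Or.inl (by rw [h])
  · exact Or.inr (Or.inr ⟨j, m, hm, by rw [h, NodeState.process_count]⟩)

lemma count_le_succ (τ : ℕ) (k : Fin n) : (R.node τ k).count ≤ (R.node (τ + 1) k).count := by
  rcases R.count_succ τ k with h | ⟨-, h⟩ | ⟨j, m, -, h⟩
  · exact h.ge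
  · rw [h]
    exact (le_suspect _ _ _).trans (le_check _ _)
  · rw [h]
    exact le_trans (fun a => le_max_left _ _) (le_check _ _)

/-- The set `recFrom` changes only when a query is completed. -/
lemma recFrom_succ (τ : ℕ) (k : Fin n) :
    (R.CompletesQuery τ k ∧ (R.node (τ + 1) k).recFrom = (R.node τ k).winners k) ∨
    (R.node (τ + 1) k).recFrom = (R.node τ k).recFrom := by
  rcases R.node_succ τ k with h | ⟨j, kept, hA, -, h⟩ | ⟨hA, -, h⟩ | ⟨j, m, hA, -, h⟩ |
    ⟨j, m, kept, hA, hm, h⟩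
  · exact Or.inr (by rw [h])
  · exact Or.inr (by rw [h])
  · by_cases hw : n - t ≤ ((R.node τ k).winners k).card
    · exact Or.inl ⟨⟨hA, hw⟩, by rw [node_succ_of_completesQuery ⟨hA, hw⟩]; rfl⟩
    · exact Or.inr (by rw [h, NodeState.testLoop, if_neg hw])
  · exact Or.inr (by rw [h])
  · exact Or.inr (by rw [h, NodeState.process_recFrom])

/-- Recorded replies persist, are erased, or come from the message being processed. -/
lemma replies_succ (τ : ℕ) (k a : Fin n) :
    (R.node (τ + 1) k).replies a = (R.node τ k).replies a ∨
    (R.CompletesQuery τ k ∧ (R.node (τ + 1) k).replies a = none) ∨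
    ((R.node τ k).replies a = none ∧ ∃ r c rf,
      (R.node τ k).inbox = some (a, .response r c rf) ∧
      (R.node (τ + 1) k).replies a = some rf) := by
  rcases R.node_succ τ k with h | ⟨j, kept, hA, -, h⟩ | ⟨hA, -, h⟩ | ⟨j, m, hA, -, h⟩ |
    ⟨j, m, kept, hA, hm, h⟩
  · exact Or.inl (by rw [h])
  · exact Or.inl (by rw [h])
  · by_cases hw : n - t ≤ ((R.node τ k).winners k).card
    · exact Or.inr (Or.inl ⟨⟨hA, hw⟩, by rw [node_succ_of_completesQuery ⟨hA, hw⟩]; rfl⟩)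
    · exact Or.inl (by rw [h, NodeState.testLoop, if_neg hw])
  · exact Or.inl (by rw [h])
  · rw [h]
    rcases (R.node τ k).process_replies (t := t) (δ := δ) k j m a with
      h' | ⟨rfl, h0, r, c, rf, rfl, h'⟩
    · exact Or.inl h'
    · exact Or.inr (Or.inr ⟨h0, r, c, rf, hm, h'⟩)

/-- A message stays in the inbox until it is processed. -/
lemma inbox_succ_of_some {τ : ℕ} {k j : Fin n} {m : Message n}
    (hm : (R.node τ k).inbox = some (j, m)) :
    (R.node (τ + 1) k).inbox = some (j, m) ∨ ∃ kept, R.action τ = .handle k kept := by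
  have hE := R.enabled τ
  rcases R.node_succ τ k with h | ⟨j', kept, hA, h0, h⟩ | ⟨hA, h0, h⟩ | ⟨j', m', hA, -, h⟩ |
    ⟨j', m', kept, hA, -, h⟩
  · exact Or.inl (by rw [h, hm])
  · simp [hm] at h0
  · simp [hm] at h0
  · rw [hA] at hE
    have h0 : (R.node τ k).inbox = none := hE.2.1
    simp [hm] at h0
  · exact Or.inr ⟨kept, hA⟩

/-- A message enters the inbox from the channel. -/
lemma inbox_succ {τ : ℕ} {k j : Fin n} {m : Message n}
    (hm : (R.node (τ + 1) k).inbox = some (j, m)) :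
    (R.node τ k).inbox = some (j, m) ∨ m ∈ (R.state τ).chan j k := by
  rcases R.node_succ τ k with h | ⟨j', kept, -, -, h⟩ | ⟨-, -, h⟩ | ⟨j', m', -, hc, h⟩ |
    ⟨j', m', kept, -, -, h⟩
  · exact Or.inl (by rw [← h, hm])
  · exact Or.inl (by rw [← hm, h])
  · left
    rw [← hm, h, NodeState.testLoop]
    split_ifs <;> rfl
  · rw [h] at hm
    cases hm
    exact Or.inr hc
  · rw [h, NodeState.process_inbox] at hm
    cases hm

lemma crashed_subset_succ (τ : ℕ) : R.F τ ⊆ R.F (τ + 1) := by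
  unfold F
  rw [R.step τ]
  cases R.action τ with
  | sendAlive i j kept => cases kept <;> exact subset_rfl
  | handle i kept =>
    rcases hm : ((R.state τ).node i).inbox with _ | ⟨j, m⟩
    · simp [Config.next, hm]
    · cases m <;> cases kept <;>
        simp [Config.next, hm, Config.transmit, Config.setNode, Config.setChan]
  | crash i => exact Finset.subset_insert _ _
  | _ => exact subset_rfl

lemma crashed_mono : Monotone R.F := monotone_nat_of_le_succ R.crashed_subset_succ

end Execution

/-! ### Sequences that are eventually monotone -/

/-- An eventually nonincreasing sequence of natural numbers is eventually constant. -/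
lemma eventually_const_of_succ_le {f : ℕ → ℕ} (h : ∀ᶠ τ in atTop, f (τ + 1) ≤ f τ) :
    ∃ v, ∀ᶠ τ in atTop, f τ = v := by
  obtain ⟨T, hT⟩ := eventually_atTop.1 h
  have hanti : ∀ s, ∀ τ ≥ s, T ≤ s → f τ ≤ f s := by
    intro s τ hτ hs
    induction τ, hτ using Nat.le_induction with
    | base => exact le_rfl
    | succ τ hτ ih => exact (hT τ (hs.trans hτ)).trans ih
  have hne : (f '' Set.Ici T).Nonempty := ⟨f T, T, Set.mem_Ici.2 le_rfl, rfl⟩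
  obtain ⟨s, hs, hmin⟩ := Nat.sInf_mem hne
  refine ⟨f s, eventually_atTop.2 ⟨s, fun τ hτ => le_antisymm (hanti s τ hτ hs) ?_⟩⟩
  rw [hmin]
  exact Nat.sInf_le ⟨τ, le_trans (b := s) hs hτ, rfl⟩

/-- A property that is eventually preserved from each index to the next, and that holds at
arbitrarily large indices, eventually holds. -/
lemma eventually_of_frequently_of_succ {p : ℕ → Prop} (hs : ∀ᶠ τ in atTop, p τ → p (τ + 1))
    (hf : ∃ᶠ τ in atTop, p τ) : ∀ᶠ τ in atTop, p τ := by
  obtain ⟨T, hT⟩ := eventually_atTop.1 hs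
  obtain ⟨s, hs, hps⟩ := frequently_atTop.1 hf T
  refine eventually_atTop.2 ⟨s, fun τ hτ => ?_⟩
  induction τ, hτ using Nat.le_induction with
  | base => exact hps
  | succ τ hτ ih => exact hT τ (le_trans hs hτ) ih

lemma frequently_succ {p : ℕ → Prop} (h : ∃ᶠ τ in atTop, p (τ + 1)) : ∃ᶠ τ in atTop, p τ := by
  rw [frequently_atTop] at h ⊢
  intro T
  obtain ⟨τ, hτ, hp⟩ := h T
  exact ⟨τ + 1, by omega, hp⟩

namespace Execution

variable {n t δ channelCapacity : ℕ} [NeZero n] {R : Execution n t δ channelCapacity}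

/-! ### Crashed nodes -/

lemma eventually_not_sends_of_faulty {a : Fin n} (ha : a ∉ R.correct) :
    ∀ᶠ τ in atTop, ∀ b m, ¬ R.Sends τ a b m := by
  obtain ⟨T, hT⟩ : a ∈ R.faulty := not_not.1 ha
  exact eventually_atTop.2 ⟨T, fun τ hτ b m h => h.not_mem_crashed (R.crashed_mono hτ hT)⟩

lemma eventually_correct_of_sends :
    ∀ᶠ τ in atTop, ∀ a b m, R.Sends τ a b m → a ∈ R.correct := by
  refine eventually_all.2 fun a => ?_
  by_cases ha : a ∈ R.correct
  · exact Eventually.of_forall fun τ b m _ => ha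
  · filter_upwards [eventually_not_sends_of_faulty ha] with τ hτ b m h
    exact absurd h (hτ b m)

lemma le_ncard_correct (hR : R.Admissible) : n - t ≤ R.correct.ncard := by
  have h := Set.ncard_add_ncard_compl R.faulty
  rw [Nat.card_eq_fintype_card, Fintype.card_fin] at h
  have := hR.failures
  unfold correct
  omega

/-! ### Disappearance of old messages -/

/-- A correct node keeps executing its loop, which it can do only with an empty inbox. -/
lemma exists_handle (hR : R.Admissible) {k j : Fin n} (hk : k ∈ R.correct) {τ : ℕ}
    {m : Message n} (hm : (R.node τ k).inbox = some (j, m)) :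
    ∃ τ' ≥ τ, (R.node τ' k).inbox = some (j, m) ∧ ∃ kept, R.action τ' = .handle k kept := by
  by_contra! hcon
  -- an unprocessed message would block the loop forever
  have hstay : ∀ τ' ≥ τ, (R.node τ' k).inbox = some (j, m) := by
    intro τ' hτ'
    induction τ', hτ' using Nat.le_induction with
    | base => exact hm
    | succ τ' hτ' ih =>
      refine (R.inbox_succ_of_some ih).resolve_right ?_
      rintro ⟨kept, hA⟩
      exact hcon τ' hτ' ih kept hA
  obtain ⟨s, hs, hloop⟩ := frequently_atTop.1 (hR.progress k hk) τ
  have hE := R.enabled s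
  have hin := hstay s hs
  cases hA : R.action s with
  | sendAlive i b kept =>
    rw [hA] at hloop hE
    obtain rfl : i = k := hloop
    have h0 : (R.node s i).inbox = none := hE.2.1
    simp [hin] at h0
  | testLoop i =>
    rw [hA] at hloop hE
    obtain rfl : i = k := hloop
    have h0 : (R.node s i).inbox = none := hE.2.1
    simp [hin] at h0
  | _ => rw [hA] at hloop; exact hloop

lemma frequently_handle_of_inbox (hR : R.Admissible) {k j : Fin n} (hk : k ∈ R.correct)
    {P : Message n → Prop}
    (h : ∃ᶠ τ in atTop, ∃ m, P m ∧ (R.node τ k).inbox = some (j, m)) :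
    ∃ᶠ τ in atTop, ∃ m, P m ∧ (R.node τ k).inbox = some (j, m) ∧
      ∃ kept, R.action τ = .handle k kept := by
  rw [frequently_atTop] at h ⊢
  intro T
  obtain ⟨τ, hτ, m, hP, hm⟩ := h T
  obtain ⟨τ', hτ', hm', hA⟩ := exists_handle hR hk hm
  exact ⟨τ', hτ.trans hτ', m, hP, hm', hA⟩

lemma frequently_inbox_of_receives {k j : Fin n} {P : Message n → Prop}
    (h : ∃ᶠ τ in atTop, ∃ m, P m ∧ R.Receives τ j k m) :
    ∃ᶠ τ in atTop, ∃ m, P m ∧ (R.node τ k).inbox = some (j, m) := by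
  refine frequently_succ (h.mono ?_)
  rintro τ ⟨m, hP, hrec⟩
  exact ⟨m, hP, by rw [node_succ_of_receive hrec]⟩

/-- A property of all messages that are eventually sent along a channel eventually holds of all
packets in it.  Packets from before that time are finitely many, and each of them leaves the channel
for good unless it is sent again. -/
lemma eventually_chan (hR : R.Admissible) {a b : Fin n} {P : Message n → Prop}
    (h : ∀ᶠ τ in atTop, ∀ m, R.Sends τ a b m → P m) :
    ∀ᶠ τ in atTop, ∀ m ∈ (R.state τ).chan a b, P m := by
  classical
  obtain ⟨T, hT⟩ := eventually_atTop.1 h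
  have hold : ∀ τ ≥ T, ∀ m ∈ (R.state τ).chan a b, P m ∨ m ∈ (R.state T).chan a b := by
    intro τ hτ
    induction τ, hτ using Nat.le_induction with
    | base => exact fun m hm => Or.inr hm
    | succ τ hτ ih =>
      intro m hm
      rcases R.mem_chan_succ hm with hm | hm
      · exact ih m hm
      · exact Or.inl (hT τ hτ m hm)
  have hgone : ∀ᶠ τ in atTop, ∀ m ∈ ((R.state T).chan a b).toFinset,
      ¬ P m → m ∉ (R.state τ).chan a b := by
    rw [eventually_all_finset]
    intro m _
    by_cases hP : P m
    · exact Eventually.of_forall fun τ hn => absurd hP hn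
    · have hnot : ∀ᶠ τ in atTop, ¬ R.Sends τ a b m :=
        h.mono fun τ hτ hs => hP (hτ m hs)
      exact (hR.residence a b m hnot).mono fun τ hτ _ => hτ
  filter_upwards [hgone, eventually_ge_atTop T] with τ hτ hge m hm
  by_contra hP
  rcases hold τ hge m hm with h' | h'
  · exact hP h'
  · exact hτ m (Multiset.mem_toFinset.2 h') hP hm

lemma eventually_inbox (hR : R.Admissible) {j k : Fin n} (hk : k ∈ R.correct)
    {P : Message n → Prop} (h : ∀ᶠ τ in atTop, ∀ m, R.Sends τ j k m → P m) :
    ∀ᶠ τ in atTop, ∀ m, (R.node τ k).inbox = some (j, m) → P m := by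
  refine eventually_of_frequently_of_succ ?_ ?_
  · filter_upwards [eventually_chan hR h] with τ hτ ih m hm
    rcases R.inbox_succ hm with hm | hm
    · exact ih m hm
    · exact hτ m hm
  · rw [frequently_atTop]
    intro T
    by_cases hin : ∃ m, (R.node T k).inbox = some (j, m)
    · obtain ⟨m, hm⟩ := hin
      obtain ⟨s, hs, hm', kept, hA⟩ := exists_handle hR hk hm
      refine ⟨s + 1, by omega, fun m' h' => ?_⟩
      rw [node_succ_of_handle hA hm', NodeState.process_inbox] at h'
      cases h'
    · exact ⟨T, le_rfl, fun m hm => absurd ⟨m, hm⟩ hin⟩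

/-! ### Every correct node completes infinitely many queries -/

lemma testLoop_toSend {s : NodeState n} {i : Fin n} :
    (s.testLoop t δ i).toSend = Finset.univ.erase i := by
  unfold NodeState.testLoop
  split_ifs <;> rfl

lemma toSend_succ (τ : ℕ) (k : Fin n) :
    (R.node (τ + 1) k).toSend = (R.node τ k).toSend ∨
    (∃ j kept, R.action τ = .sendAlive k j kept ∧
      (R.node (τ + 1) k).toSend = (R.node τ k).toSend.erase j) ∨
    (R.action τ = .testLoop k ∧ (R.node (τ + 1) k).toSend = Finset.univ.erase k) := by
  rcases R.node_succ τ k with h | ⟨j, kept, hA, -, h⟩ | ⟨hA, -, h⟩ | ⟨j, m, hA, -, h⟩ |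
    ⟨j, m, kept, hA, hm, h⟩
  · exact Or.inl (by rw [h])
  · exact Or.inr (Or.inl ⟨j, kept, hA, by rw [h]⟩)
  · exact Or.inr (Or.inr ⟨hA, by rw [h, testLoop_toSend]⟩)
  · exact Or.inl (by rw [h])
  · exact Or.inl (by rw [h, NodeState.process_toSend])

/-- Each pass through the loop of a correct node ends, since every query that is sent leaves one
addressee fewer. -/
lemma frequently_testLoop (hR : R.Admissible) {k : Fin n} (hk : k ∈ R.correct) :
    ∃ᶠ τ in atTop, R.action τ = .testLoop k := by
  intro hnot
  obtain ⟨v, hv⟩ := eventually_const_of_succ_le (f := fun τ => (R.node τ k).toSend.card) (by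
    filter_upwards [hnot] with τ hτ
    rcases R.toSend_succ τ k with h | ⟨j, kept, -, h⟩ | ⟨h, -⟩
    · rw [h]
    · rw [h]
      exact Finset.card_le_card (Finset.erase_subset _ _)
    · exact absurd h hτ)
  obtain ⟨T, hT⟩ := eventually_atTop.1 (hv.and hnot)
  obtain ⟨s, hs, hloop⟩ := frequently_atTop.1 (hR.progress k hk) T
  have hE := R.enabled s
  cases hA : R.action s with
  | sendAlive i b kept =>
    rw [hA] at hloop hE
    obtain rfl : i = k := hloop
    have hb : b ∈ (R.node s i).toSend := hE.2.2
    have h1 := (hT s hs).1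
    have h2 := (hT (s + 1) (by omega)).1
    simp only [node_succ_of_sendAlive hA] at h2
    have := Finset.card_erase_lt_of_mem hb
    omega
  | testLoop i =>
    rw [hA] at hloop
    obtain rfl : i = k := hloop
    exact (hT s hs).2 hA
  | _ => rw [hA] at hloop; exact hloop

/-- Each pass through the loop sends the query to every other node before the next `until` test. -/
lemma frequently_sendAlive (hR : R.Admissible) {k j : Fin n} (hk : k ∈ R.correct) (hjk : j ≠ k) :
    ∃ᶠ τ in atTop, ∃ kept, R.action τ = .sendAlive k j kept := by
  intro hnot
  have hmem : ∀ᶠ τ in atTop, j ∈ (R.node τ k).toSend := by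
    have hreset : ∃ᶠ τ in atTop, j ∈ (R.node (τ + 1) k).toSend := by
      refine (frequently_testLoop hR hk).mono fun τ hA => ?_
      rw [node_succ_of_testLoop hA, testLoop_toSend]
      exact Finset.mem_erase.2 ⟨hjk, Finset.mem_univ _⟩
    refine eventually_of_frequently_of_succ ?_
      (frequently_succ (p := fun τ => j ∈ (R.node τ k).toSend) hreset)
    filter_upwards [hnot] with τ hτ ih
    rcases R.toSend_succ τ k with h | ⟨b, kept, hA, h⟩ | ⟨-, h⟩
    · rwa [h]
    · rw [h]
      refine Finset.mem_erase.2 ⟨?_, ih⟩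
      rintro rfl
      exact hτ ⟨kept, hA⟩
    · rw [h]
      exact Finset.mem_erase.2 ⟨hjk, Finset.mem_univ _⟩
  obtain ⟨τ, hA, hτ⟩ := ((frequently_testLoop hR hk).and_eventually hmem).exists
  have hE := R.enabled τ
  rw [hA] at hE
  have h0 : (R.node τ k).toSend = ∅ := hE.2.2
  simp [h0] at hτ

/-- A query sent over and over again to a correct node is answered over and over again. -/
lemma frequently_handle_response (hR : R.Admissible) {k j : Fin n} (hk : k ∈ R.correct)
    (hj : j ∈ R.correct) {r : ℕ}
    (h : ∃ᶠ τ in atTop, ∃ m, m.tag = (Kind.alive, r) ∧ R.Sends τ k j m) :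
    ∃ᶠ τ in atTop, ∃ m, m.tag = (Kind.response, r) ∧ (R.node τ k).inbox = some (j, m) ∧
      ∃ kept, R.action τ = .handle k kept := by
  have h1 := frequently_handle_of_inbox hR hj
    (frequently_inbox_of_receives (hR.fair k j _ hj h))
  refine frequently_handle_of_inbox hR hk
    (frequently_inbox_of_receives (hR.fair j k (.response, r) hk (h1.mono ?_)))
  rintro τ ⟨m, htag, hm, kept, hA⟩
  unfold node at hm
  cases m with
  | response r' c rf => cases htag
  | alive r' c =>
    obtain rfl : r' = r := congrArg Prod.snd htag
    exact ⟨Config.replyTo r' (((R.state τ).node j).absorb δ c), rfl, by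
      simp [Sends, hA, Config.sent, hm]⟩

/-- If a correct node completed no more queries, its round number would be constant, every correct
node would answer its query, and these answers are enough to complete it. -/
lemma frequently_completesQuery (hR : R.Admissible) {k : Fin n} (hk : k ∈ R.correct) :
    ∃ᶠ τ in atTop, R.CompletesQuery τ k := by
  intro hnot
  obtain ⟨T, hT⟩ := eventually_atTop.1 hnot
  have hround : ∀ τ ≥ T, (R.node τ k).r = (R.node T k).r := by
    intro τ hτ
    induction τ, hτ using Nat.le_induction with
    | base => rfl
    | succ τ hτ ih =>
      rw [← ih]
      rcases R.node_succ τ k with h | ⟨j, kept, hA, -, h⟩ | ⟨hA, -, h⟩ | ⟨j, m, hA, -, h⟩ |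
        ⟨j, m, kept, hA, hm, h⟩
      · rw [h]
      · rw [h]
      · have hw : ¬ n - t ≤ ((R.node τ k).winners k).card := fun hw => hT τ hτ ⟨hA, hw⟩
        rw [h, NodeState.testLoop, if_neg hw]
      · rw [h]
      · rw [h, NodeState.process_r]
  have hwin : ∀ τ ≥ T, (R.node τ k).winners k ⊆ (R.node (τ + 1) k).winners k := by
    intro τ hτ a ha
    rw [NodeState.mem_winners] at ha ⊢
    rcases R.replies_succ τ k a with h | ⟨h, -⟩ | ⟨h, -⟩
    · rwa [h]
    · exact absurd h (hT τ hτ)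
    · exact Or.inl (ha.resolve_right (by simp [h]))
  have hev : ∀ j ∈ R.correct, ∀ᶠ τ in atTop,
      j ∈ (R.node τ k).winners k ∨ n - t ≤ ((R.node τ k).winners k).card := by
    intro j hj
    by_cases hjk : j = k
    · exact Eventually.of_forall fun τ => Or.inl (NodeState.mem_winners.2 (Or.inl hjk))
    refine eventually_of_frequently_of_succ ?_ ?_
    · filter_upwards [eventually_ge_atTop T] with τ hτ
      exact Or.imp (fun h => hwin τ hτ h) (fun h => h.trans (Finset.card_le_card (hwin τ hτ)))
    · have hsend : ∃ᶠ τ in atTop, ∃ m, m.tag = (Kind.alive, (R.node T k).r) ∧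
          R.Sends τ k j m := by
        refine ((frequently_sendAlive hR hk hjk).and_eventually (eventually_ge_atTop T)).mono ?_
        rintro τ ⟨⟨kept, hA⟩, hτ⟩
        refine ⟨.alive (R.node τ k).r (R.node τ k).count, ?_, ?_⟩
        · rw [← hround τ hτ]; rfl
        · unfold Sends; rw [hA]; rfl
      refine frequently_succ (((frequently_handle_response hR hk hj hsend).and_eventually
        (eventually_ge_atTop T)).mono ?_)
      rintro τ ⟨⟨m, htag, hm, kept, hA⟩, hτ⟩
      cases m with
      | alive r' c => cases htag
      | response r' c rf =>
        obtain rfl : r' = (R.node τ k).r := by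
          rw [hround τ hτ]; exact congrArg Prod.snd htag
        rw [node_succ_of_handle hA hm]
        exact NodeState.mem_winners_process _ _ _ _ _
  have hev' : ∀ᶠ τ in atTop, ∀ j, j ∈ R.correct →
      j ∈ (R.node τ k).winners k ∨ n - t ≤ ((R.node τ k).winners k).card := by
    refine eventually_all.2 fun j => ?_
    by_cases hj : j ∈ R.correct
    · exact (hev j hj).mono fun τ h _ => h
    · exact Eventually.of_forall fun τ h => absurd h hj
  obtain ⟨τ, hA, hτ, hno⟩ := ((frequently_testLoop hR hk).and_eventually (hev'.and hnot)).exists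
  refine hno ⟨hA, ?_⟩
  by_contra hlt
  have hsub : R.correct ⊆ ((R.node τ k).winners k : Set (Fin n)) := fun j hj =>
    (hτ j hj).resolve_right hlt
  have := Set.ncard_le_ncard hsub
  rw [Set.ncard_coe_finset] at this
  exact hlt ((le_ncard_correct hR).trans this)

end Execution

namespace Execution

variable {n t δ channelCapacity : ℕ} [NeZero n] {R : Execution n t δ channelCapacity}

/-! ### Replies and winners in the long run -/

/-- Recorded replies are forgotten whenever a query is completed, so only late messages matter. -/
lemma eventually_replies_of_inbox (hR : R.Admissible) {j k : Fin n} (hk : k ∈ R.correct)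
    {P : Finset (Fin n) → Prop}
    (h : ∀ᶠ τ in atTop, ∀ r c rf, (R.node τ k).inbox = some (j, .response r c rf) → P rf) :
    ∀ᶠ τ in atTop, ∀ rf, (R.node τ k).replies j = some rf → P rf := by
  refine eventually_of_frequently_of_succ ?_
    (frequently_succ ((frequently_completesQuery hR hk).mono ?_))
  · filter_upwards [h] with τ hτ ih rf hrf
    rcases R.replies_succ τ k j with h' | ⟨-, h'⟩ | ⟨-, r, c, rf', hin, h'⟩
    · exact ih rf (h' ▸ hrf)
    · simp [h'] at hrf
    · rw [h', Option.some.injEq] at hrf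
      exact hrf ▸ hτ r c rf' hin
  · intro τ hτ rf hrf
    rw [node_succ_of_completesQuery hτ] at hrf
    cases hrf

lemma eventually_replies (hR : R.Admissible) {j k : Fin n} (hk : k ∈ R.correct)
    {P : Finset (Fin n) → Prop}
    (h : ∀ᶠ τ in atTop, ∀ r c rf, R.Sends τ j k (.response r c rf) → P rf) :
    ∀ᶠ τ in atTop, ∀ rf, (R.node τ k).replies j = some rf → P rf := by
  refine eventually_replies_of_inbox hR hk ?_
  have := eventually_inbox hR hk (j := j)
    (P := fun m => ∀ r c rf, m = .response r c rf → P rf)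
    (h.mono fun τ hτ m hm r c rf hmr => hτ r c rf (hmr ▸ hm))
  exact this.mono fun τ hτ r c rf hin => hτ _ hin r c rf rfl

/-- Replies carry the sender's `recFrom`, so an eventual property of the latter passes to them.  A
faulty sender needs no hypothesis, since its replies disappear. -/
lemma eventually_replies_of_recFrom (hR : R.Admissible) {j k : Fin n} (hk : k ∈ R.correct)
    {P : Finset (Fin n) → Prop}
    (h : j ∈ R.correct → ∀ᶠ τ in atTop, P (R.node τ j).recFrom) :
    ∀ᶠ τ in atTop, ∀ rf, (R.node τ k).replies j = some rf → P rf := by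
  refine eventually_replies hR hk ?_
  by_cases hj : j ∈ R.correct
  · filter_upwards [h hj] with τ hτ r c rf hs
    exact hs.recFrom_eq ▸ hτ
  · filter_upwards [eventually_not_sends_of_faulty hj] with τ hτ r c rf hs
    exact absurd hs (hτ _ _)

lemma eventually_recFrom (hR : R.Admissible) {k : Fin n} (hk : k ∈ R.correct)
    {P : Finset (Fin n) → Prop}
    (h : ∀ᶠ τ in atTop, R.CompletesQuery τ k → P ((R.node τ k).winners k)) :
    ∀ᶠ τ in atTop, P (R.node τ k).recFrom := by
  refine eventually_of_frequently_of_succ ?_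
    (frequently_succ (((frequently_completesQuery hR hk).and_eventually h).mono ?_))
  · filter_upwards [h] with τ hτ ih
    rcases R.recFrom_succ τ k with ⟨hc, h'⟩ | h'
    · exact h' ▸ hτ hc
    · exact h' ▸ ih
  · rintro τ ⟨hc, hτ⟩
    rw [node_succ_of_completesQuery hc]
    exact hτ hc

lemma eventually_winners_correct (hR : R.Admissible) {k : Fin n} (hk : k ∈ R.correct) :
    ∀ᶠ τ in atTop, ∀ j ∈ (R.node τ k).winners k, j ∈ R.correct := by
  refine eventually_all.2 fun j => ?_
  have := eventually_replies_of_recFrom hR hk (j := j) (P := fun _ => j ∈ R.correct)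
    fun hj => Eventually.of_forall fun _ => hj
  filter_upwards [this] with τ hτ hw
  rcases NodeState.mem_winners.1 hw with rfl | hs
  · exact hk
  · obtain ⟨rf, hrf⟩ := Option.isSome_iff_exists.1 hs
    exact hτ rf hrf

/-- A faulty node is eventually missing from the answers on which suspicions are based. -/
lemma eventually_not_mem_prevRecFrom (hR : R.Admissible) {k l : Fin n} (hk : k ∈ R.correct)
    (hl : l ∉ R.correct) : ∀ᶠ τ in atTop, l ∉ (R.node τ k).prevRecFrom := by
  have hrec : ∀ j ∈ R.correct, ∀ᶠ τ in atTop, l ∉ (R.node τ j).recFrom := fun j hj =>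
    eventually_recFrom hR hj (P := fun s => l ∉ s)
      ((eventually_winners_correct hR hj).mono fun τ hτ _ hmem => hl (hτ l hmem))
  have hrep := eventually_all.2 fun j : Fin n =>
    eventually_replies_of_recFrom hR hk (j := j) (P := fun s => l ∉ s) (hrec j)
  filter_upwards [hrec k hk, hrep] with τ h1 h2 hmem
  rcases Finset.mem_union.1 hmem with h | h
  · exact h1 h
  · obtain ⟨j, -, hj⟩ := Finset.mem_biUnion.1 h
    rcases hs : (R.node τ k).replies j with _ | rf
    · simp [hs] at hj
    · exact h2 j rf hs (by simpa [hs] using hj)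

/-- Under the message pattern, `p_i` is eventually never suspected: the `n - t` winners of a query
meet the `t + 1` nodes of `Q`, and the reply of a node of `Q` eventually names `p_i`. -/
lemma eventually_mem_prevRecFrom (hR : R.Admissible) {i : Fin n} {Q : Finset (Fin n)}
    (hQ : Q.card = t + 1)
    (hE : ∀ᶠ τ in atTop, ∀ j ∈ Q, R.CompletesQuery τ j → i ∈ (R.node τ j).winners j)
    {k : Fin n} (hk : k ∈ R.correct) :
    ∀ᶠ τ in atTop, R.CompletesQuery τ k → i ∈ (R.node τ k).prevRecFrom := by
  have hrec : ∀ j ∈ R.correct, ∀ᶠ τ in atTop, j ∈ Q → i ∈ (R.node τ j).recFrom := fun j hj =>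
    eventually_recFrom hR hj (P := fun s => j ∈ Q → i ∈ s)
      (hE.mono fun τ hτ hc hjQ => hτ j hjQ hc)
  have hrep := eventually_all.2 fun j : Fin n =>
    eventually_replies_of_recFrom hR hk (j := j) (P := fun s => j ∈ Q → i ∈ s) (hrec j)
  filter_upwards [hrec k hk, hrep] with τ h1 h2 hc
  obtain ⟨j, hj⟩ : (((R.node τ k).winners k) ∩ Q).Nonempty := by
    refine Finset.inter_nonempty_of_card_lt_card_add_card (Finset.subset_univ _)
      (Finset.subset_univ _) ?_
    have : n - t ≤ ((R.node τ k).winners k).card := hc.2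
    rw [Finset.card_univ, Fintype.card_fin]
    omega
  obtain ⟨hjw, hjQ⟩ := Finset.mem_inter.1 hj
  refine Finset.mem_union.2 ?_
  rcases NodeState.mem_winners.1 hjw with rfl | hs
  · exact Or.inl (h1 hjQ)
  · obtain ⟨rf, hrf⟩ := Option.isSome_iff_exists.1 hs
    exact Or.inr (Finset.mem_biUnion.2
      ⟨j, Finset.mem_univ _, by simpa [hrf] using h2 j rf hrf hjQ⟩)

/-! ### The counters of correct nodes stabilize -/

lemma balanced_count (hcons : R.ConsistentAt 0) {k : Fin n} (hk : k ∈ R.correct) (τ : ℕ) :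
    Balanced δ (R.node τ k).count := by
  induction τ with
  | zero => exact balanced_iff.2 (hcons k hk)
  | succ τ ih =>
    rcases R.count_succ τ k with h | ⟨-, h⟩ | ⟨j, m, -, h⟩
    · rwa [h]
    · rw [h]; exact balanced_check _ _
    · rw [h]; exact balanced_check _ _

lemma eventually_inbox_balanced (hR : R.Admissible) (hcons : R.ConsistentAt 0) {k : Fin n}
    (hk : k ∈ R.correct) :
    ∀ᶠ τ in atTop, ∀ j m, (R.node τ k).inbox = some (j, m) → Balanced δ m.count := by
  refine eventually_all.2 fun j => eventually_inbox hR hk ?_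
  filter_upwards [eventually_correct_of_sends (R := R)] with τ hτ m hs
  rw [hs.count_eq]
  exact balanced_count hcons (hτ _ _ _ hs) _

/-- Once all vectors in use are balanced, `check` has no effect, and the counter of a node that is
no longer suspected can only be copied from one place to another; so it is bounded. -/
lemma exists_bound_count (hR : R.Admissible) (hcons : R.ConsistentAt 0) {i : Fin n}
    (hi : ∀ k ∈ R.correct, ∀ᶠ τ in atTop, R.CompletesQuery τ k → i ∈ (R.node τ k).prevRecFrom) :
    ∃ B, ∀ᶠ τ in atTop, ∀ k ∈ R.correct, (R.node τ k).count i ≤ B := by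
  have hall : ∀ᶠ τ in atTop, ∀ k, k ∈ R.correct →
      (∀ j m, (R.node τ k).inbox = some (j, m) → Balanced δ m.count) ∧
      (R.CompletesQuery τ k → i ∈ (R.node τ k).prevRecFrom) := by
    refine eventually_all.2 fun k => ?_
    by_cases hk : k ∈ R.correct
    · exact ((eventually_inbox_balanced hR hcons hk).and (hi k hk)).mono fun τ h _ => h
    · exact Eventually.of_forall fun τ h => absurd h hk
  obtain ⟨T, hT⟩ := eventually_atTop.1 (hall.and (eventually_correct_of_sends (R := R)))
  have hB : ∃ B, (∀ k, (R.node T k).count i ≤ B) ∧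
      (∀ k j m, (R.node T k).inbox = some (j, m) → m.count i ≤ B) ∧
      (∀ a b, ∀ m ∈ (R.state T).chan a b, m.count i ≤ B) := by
    have hb : ∀ k, ∃ B, ∀ j m, (R.node T k).inbox = some (j, m) → m.count i ≤ B := by
      intro k
      rcases hin : (R.node T k).inbox with _ | ⟨j, m⟩
      · exact ⟨0, fun j m h => by cases h⟩
      · exact ⟨m.count i, fun j m h => by cases h; exact le_rfl⟩
    choose b hb using hb
    let g : Fin n → Fin n → ℕ := fun a b => (((R.state T).chan a b).map fun m => m.count i).sup
    refine ⟨Finset.univ.sup (fun k => (R.node T k).count i) ⊔ Finset.univ.sup b ⊔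
      Finset.univ.sup (fun a => Finset.univ.sup (g a)), fun k => ?_, fun k j m h => ?_,
      fun a b m hm => ?_⟩
    · exact le_sup_of_le_left (le_sup_of_le_left
        (Finset.le_sup (f := fun k => (R.node T k).count i) (Finset.mem_univ k)))
    · exact le_sup_of_le_left (le_sup_of_le_right
        ((hb k j m h).trans (Finset.le_sup (Finset.mem_univ k))))
    · refine le_sup_of_le_right (le_trans (b := g a b) ?_ (le_trans
        (Finset.le_sup (Finset.mem_univ b))
        (Finset.le_sup (f := fun a => Finset.univ.sup (g a)) (Finset.mem_univ a))))
      exact Multiset.le_sup (Multiset.mem_map_of_mem (fun m : Message n => m.count i) hm)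
  obtain ⟨B, hB1, hB2, hB3⟩ := hB
  have hinv : ∀ τ ≥ T, (∀ k ∈ R.correct, (R.node τ k).count i ≤ B) ∧
      (∀ k j m, (R.node τ k).inbox = some (j, m) → m.count i ≤ B) ∧
      (∀ a b, ∀ m ∈ (R.state τ).chan a b, m.count i ≤ B) := by
    intro τ hτ
    induction τ, hτ using Nat.le_induction with
    | base => exact ⟨fun k _ => hB1 k, hB2, hB3⟩
    | succ τ hτ ih =>
      obtain ⟨ih1, ih2, ih3⟩ := ih
      have hnode : ∀ k ∈ R.correct, (R.node (τ + 1) k).count i ≤ B := by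
        intro k hk
        rcases R.count_succ τ k with h | ⟨hc, h⟩ | ⟨j, m, hm, h⟩
        · rw [h]; exact ih1 k hk
        · rw [h, ((balanced_count hcons hk τ).suspect _).check_eq]
          unfold suspect
          rw [if_neg fun hn => hn.1 (((hT τ hτ).1 k hk).2 hc)]
          exact ih1 k hk
        · rw [h, ((balanced_count hcons hk τ).merge (((hT τ hτ).1 k hk).1 j m hm)).check_eq]
          exact max_le (ih1 k hk) (ih2 k j m hm)
      refine ⟨hnode, fun k j m hm => ?_, fun a b m hm => ?_⟩
      · rcases R.inbox_succ hm with hm | hm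
        · exact ih2 k j m hm
        · exact ih3 j k m hm
      · rcases R.mem_chan_succ hm with hm | hm
        · exact ih3 a b m hm
        · rw [hm.count_eq]
          exact hnode a ((hT τ hτ).2 a b m hm)
  exact ⟨B, eventually_atTop.2 ⟨T, fun τ hτ => (hinv τ hτ).1⟩⟩

/-- One bounded counter bounds all counters of a balanced vector, and counters never decrease. -/
lemma exists_eventually_count_eq (hcons : R.ConsistentAt 0) {i : Fin n} {B : ℕ}
    (hB : ∀ᶠ τ in atTop, ∀ k ∈ R.correct, (R.node τ k).count i ≤ B) {k : Fin n}
    (hk : k ∈ R.correct) : ∃ c, ∀ᶠ τ in atTop, (R.node τ k).count = c := by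
  have hbound : ∀ᶠ τ in atTop, ∀ a, (R.node τ k).count a ≤ B + δ := by
    filter_upwards [hB] with τ hτ a
    exact (balanced_count hcons hk τ a i).trans (Nat.add_le_add_right (hτ k hk) δ)
  have hconst : ∀ a, ∃ v, ∀ᶠ τ in atTop, (R.node τ k).count a = v := by
    intro a
    -- truncated at `B + δ`, which matters only while the bound does not hold yet
    obtain ⟨v, hv⟩ := eventually_const_of_succ_le
      (f := fun τ => B + δ - (R.node τ k).count a)
      (Eventually.of_forall fun τ => Nat.sub_le_sub_left (R.count_le_succ τ k a) _)
    refine ⟨B + δ - v, ?_⟩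
    filter_upwards [hv, hbound] with τ h1 h2
    have := h2 a
    omega
  choose c hc using hconst
  exact ⟨c, (eventually_all.2 hc).mono fun τ hτ => funext hτ⟩

/-! ### Agreement -/

/-- A node that processes messages of `p_j` over and over again ends with counters at least as large
as the final ones of `p_j`. -/
lemma le_of_frequently_inbox (hR : R.Admissible) {c : Fin n → Fin n → ℕ}
    (hc : ∀ k ∈ R.correct, ∀ᶠ τ in atTop, (R.node τ k).count = c k) {j k : Fin n}
    (hj : j ∈ R.correct) (hk : k ∈ R.correct)
    (h : ∃ᶠ τ in atTop, ∃ m, (R.node τ k).inbox = some (j, m)) : c j ≤ c k := by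
  have hcount : ∀ᶠ τ in atTop, ∀ m, (R.node τ k).inbox = some (j, m) → m.count = c j := by
    refine eventually_inbox hR hk ?_
    filter_upwards [(tendsto_add_atTop_nat 1).eventually (hc j hj)] with τ hτ m hs
    rw [hs.count_eq, hτ]
  have hh := frequently_handle_of_inbox hR hk (j := j) (P := fun _ => True)
    (h.mono fun τ ⟨m, hm⟩ => ⟨m, trivial, hm⟩)
  obtain ⟨τ, ⟨m, -, hm, kept, hA⟩, h1, h2⟩ := (hh.and_eventually (hcount.and
    ((tendsto_add_atTop_nat 1).eventually (hc k hk)))).exists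
  rw [← h2, node_succ_of_handle hA hm, NodeState.process_count, ← h1 m hm]
  exact le_trans (fun a => le_max_right _ _) (le_check _ _)

/-- If `p_k` records replies of `p_j` over and over again, then `p_j` processes queries of `p_k` over
and over again, so that the final counters of each are at least those of the other. -/
lemma eq_of_frequently_replies (hR : R.Admissible) {c : Fin n → Fin n → ℕ}
    (hc : ∀ k ∈ R.correct, ∀ᶠ τ in atTop, (R.node τ k).count = c k) {j k : Fin n}
    (hk : k ∈ R.correct) (h : ∃ᶠ τ in atTop, ((R.node τ k).replies j).isSome) : c j = c k := by
  have hnot : ¬ ∀ᶠ τ in atTop, ∀ rf, (R.node τ k).replies j = some rf → False := by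
    intro hev
    obtain ⟨τ, hs, hτ⟩ := (h.and_eventually hev).exists
    obtain ⟨rf, hrf⟩ := Option.isSome_iff_exists.1 hs
    exact hτ rf hrf
  have hin : ∃ᶠ τ in atTop, ∃ m, (R.node τ k).inbox = some (j, m) := by
    intro hev
    exact hnot (eventually_replies_of_inbox hR hk (hev.mono fun τ hτ r c rf hm => hτ ⟨_, hm⟩))
  have hsend : ∃ᶠ τ in atTop, ∃ r c rf, R.Sends τ j k (.response r c rf) := by
    intro hev
    exact hnot (eventually_replies hR hk (hev.mono fun τ hτ r c rf hs => hτ ⟨r, c, rf, hs⟩))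
  have hj : j ∈ R.correct := by
    by_contra hj
    obtain ⟨τ, ⟨r, c, rf, hs⟩, hτ⟩ :=
      (hsend.and_eventually (eventually_not_sends_of_faulty hj)).exists
    exact hτ _ _ hs
  have hin' : ∃ᶠ τ in atTop, ∃ m, (R.node τ j).inbox = some (k, m) := by
    refine hsend.mono ?_
    rintro τ ⟨r, c, rf, hs⟩
    rcases hs.cases with ⟨kept, hA, h⟩ | ⟨kept, r, c, hA, hm, -⟩
    · cases h
    · exact ⟨_, hm⟩
  exact le_antisymm (le_of_frequently_inbox hR hc hj hk hin)
    (le_of_frequently_inbox hR hc hk hj hin')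

/-- Two correct nodes have majorities of recurrent winners, and these meet. -/
lemma final_count_eq (ht : 2 * t < n) (hR : R.Admissible) {c : Fin n → Fin n → ℕ}
    (hc : ∀ k ∈ R.correct, ∀ᶠ τ in atTop, (R.node τ k).count = c k) {k k' : Fin n}
    (hk : k ∈ R.correct) (hk' : k' ∈ R.correct) : c k = c k' := by
  classical
  have hmaj : ∀ k ∈ R.correct, n - t ≤ (Finset.univ.filter fun j => c j = c k).card := by
    intro k hk
    have hev : ∀ᶠ τ in atTop, ∀ j ∈ (R.node τ k).winners k, c j = c k := by
      refine eventually_all.2 fun j => ?_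
      by_cases hjk : c j = c k
      · exact Eventually.of_forall fun _ _ => hjk
      · have hno := not_frequently.1 (mt (eq_of_frequently_replies hR hc hk) hjk)
        filter_upwards [hno] with τ hτ hw
        rcases NodeState.mem_winners.1 hw with rfl | hs
        · rfl
        · exact absurd hs hτ
    obtain ⟨τ, hq, hτ⟩ := ((frequently_completesQuery hR hk).and_eventually hev).exists
    exact le_trans hq.2 (Finset.card_le_card fun j hj =>
      Finset.mem_filter.2 ⟨Finset.mem_univ _, hτ j hj⟩)
  have h1 := hmaj k hk
  have h2 := hmaj k' hk'
  obtain ⟨j, hj⟩ := Finset.inter_nonempty_of_card_lt_card_add_card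
    (Finset.subset_univ (Finset.univ.filter fun j => c j = c k))
    (Finset.subset_univ (Finset.univ.filter fun j => c j = c k')) (by
      rw [Finset.card_univ, Fintype.card_fin]; omega)
  simp only [Finset.mem_inter, Finset.mem_filter, Finset.mem_univ, true_and] at hj
  exact hj.1.symm.trans hj.2

/-- A faulty node is suspected at each completed query, so in the final counters it lies at distance
`δ` above the minimum and cannot be the leader. -/
lemma leader_mem_correct (hδ : 0 < δ) (hR : R.Admissible) {c : Fin n → ℕ} {k : Fin n}
    (hk : k ∈ R.correct) (hc : ∀ᶠ τ in atTop, (R.node τ k).count = c) :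
    leader c ∈ R.correct := by
  by_contra hl
  obtain ⟨τ, hq, h1, h2, h3⟩ := ((frequently_completesQuery hR hk).and_eventually
    (hc.and (((tendsto_add_atTop_nat 1).eventually hc).and
      (eventually_not_mem_prevRecFrom hR hk hl)))).exists
  -- the completed query leaves the counters at `c`, so the suspicion cannot have raised them
  have hle : suspect δ (R.node τ k).prevRecFrom c (leader c) ≤ c (leader c) := by
    have h := le_check δ (suspect δ (R.node τ k).prevRecFrom c) (leader c)
    rw [node_succ_of_completesQuery hq] at h2
    simp only [NodeState.endIteration, h1] at h2
    rwa [h2] at h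
  obtain ⟨b, hb⟩ := exists_eq_minCount c
  have hmin := leader_count_le c b
  unfold suspect at hle
  rw [if_pos ⟨h3, by omega⟩] at hle
  omega

end Execution
end OmegaFD

theorem mainTheorem2 {n : ℕ} [NeZero n] (t δ channelCapacity : ℕ) (ht : 2 * t < n) (hδ : 0 < δ)
    (R : OmegaFD.Execution n t δ channelCapacity) (hR : R.Admissible)
    (hcons : R.ConsistentAt 0) (hEMP : R.EventualMessagePattern) :
    R.ImplementsOmega := by
  refine ⟨fun i τ => Finset.mem_univ _, ?_⟩
  obtain ⟨T, i, hi, Q, hQ, hE⟩ := hEMP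
  have hE' : ∀ᶠ τ in Filter.atTop, ∀ j ∈ Q, R.CompletesQuery τ j → i ∈ (R.node τ j).winners j :=
    Filter.eventually_atTop.2 ⟨T, fun τ hτ j hj hq => hE j hj τ hτ hq⟩
  obtain ⟨B, hB⟩ := R.exists_bound_count hR hcons fun k hk =>
    R.eventually_mem_prevRecFrom hR hQ hE' hk
  have hc : ∀ k, ∃ c, k ∈ R.correct → ∀ᶠ τ in Filter.atTop, (R.node τ k).count = c := by
    intro k
    by_cases hk : k ∈ R.correct
    · obtain ⟨c, hc⟩ := R.exists_eventually_count_eq hcons hB hk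
      exact ⟨c, fun _ => hc⟩
    · exact ⟨0, fun h => absurd h hk⟩
  choose c hc using hc
  have hev : ∀ᶠ τ in Filter.atTop, ∀ k, k ∈ R.correct → (R.node τ k).count = c i := by
    refine Filter.eventually_all.2 fun k => ?_
    by_cases hk : k ∈ R.correct
    · rw [R.final_count_eq ht hR hc hi hk]
      exact (hc k hk).mono fun τ h _ => h
    · exact Filter.Eventually.of_forall fun τ h => absurd h hk
  obtain ⟨τ₀, hτ₀⟩ := Filter.eventually_atTop.1 hev
  exact ⟨OmegaFD.leader (c i), R.leader_mem_correct hδ hR hi (hc i hi), τ₀,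
    fun τ hτ k hk => congrArg OmegaFD.leader (hτ₀ τ hτ k hk)⟩
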